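/- For a binary string $x=x_0\cdots x_{N-1}\in\{0,1\}^N$ and a query string $s\in\bigcup_{k=1}^{N}\{0,1\}^k$, let $\chi(x;s)=1$ if $s$ is a substring of $x$ (that is, occurs in $x$ as a block of consecutive letters), and $\chi(x;s)=0$ otherwise. The quantum substring oracle of $x$ is the unitary transformation $|s\rangle|a\rangle|w\rangle\mapsto|s\rangle|a\oplus\chi(x;s)\rangle|w\rangle$, where $a\in\{0,1\}$ and $w$ ranges over the basis states of a finite work register. A quantum algorithm with $T$ queries starts in a fixed basis state, applies unitary transformations $U_0,\dots,U_T$ that do not depend on $x$, with one application of the oracle between any two consecutive ones, and finally measures in the computational basis and outputs a function of the result. Theorem. There is a constant $C$ such that for every $N\ge 2$ there is a quantum algorithm which makes at most $\frac34 N+C\sqrt N\log N$ queries and which, for every $x\in\{0,1\}^N$, given the substring oracle of $x$, outputs $x$ with probability $1$. In other words, the exact quantum query complexity of identifying an unknown $N$-bit string from its substring oracle is at most $\frac34 N+O(\sqrt N\log N)$. -/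

import Mathlib

/-- A quantum query algorithm for oracles `Q → {0,1}`, with outputs in `Y`.
Its basis states are `|q, a, w⟩` with a query `q`, an answer bit `a` and the content `w` of a
finite work register. It starts in the basis state `init` and applies
`U 0, O, U 1, O, …, O, U queries`, where `O` is the oracle; at the end all the registers are
measured in the computational basis, and on result `b` the algorithm outputs `out b`.
No component of the algorithm depends on the oracle. -/
structure QueryAlgorithm (Q Y : Type) [Fintype Q] [DecidableEq Q] where
  /-- the basis of the work register -/
  W : Type
  [fintypeW : Fintype W]
  [decidableEqW : DecidableEq W]
  /-- the number of oracle calls -/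
  queries : ℕ
  /-- the initial basis state -/
  init : Q × Bool × W
  /-- the unitary transformations between the oracle calls (those after `U queries` are unused) -/
  U : ℕ → Matrix.unitaryGroup (Q × Bool × W) ℂ
  /-- the output as a function of the measurement result -/
  out : Q × Bool × W → Y

namespace QueryAlgorithm

attribute [instance] QueryAlgorithm.fintypeW QueryAlgorithm.decidableEqW

/-- The oracle transformation `|q, a, w⟩ ↦ |q, a ⊕ χ q, w⟩`, extended linearly, written in terms of
amplitudes (the permutation of the basis states is an involution). -/
def applyOracle {Q W : Type} (χ : Q → Bool) (ψ : Q × Bool × W → ℂ) : Q × Bool × W → ℂ :=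
  fun b => ψ (b.1, xor b.2.1 (χ b.1), b.2.2)

theorem applyOracle_single {Q W : Type} [DecidableEq Q] [DecidableEq W] (χ : Q → Bool)
    (q : Q) (a : Bool) (w : W) :
    applyOracle χ (Pi.single (q, a, w) 1) = Pi.single (q, xor a (χ q), w) 1 := by
  funext ⟨q', a', w'⟩
  simp only [applyOracle, Pi.single_apply, Prod.mk.injEq]
  congr 1
  apply propext
  constructor
  · rintro ⟨rfl, h, rfl⟩
    exact ⟨rfl, by rw [← h]; cases a' <;> cases χ q' <;> rfl, rfl⟩
  · rintro ⟨rfl, h, rfl⟩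
    exact ⟨rfl, by rw [h]; cases a <;> cases χ q' <;> rfl, rfl⟩

variable {Q Y : Type} [Fintype Q] [DecidableEq Q]

/-- The state (vector of amplitudes) after `t` calls of the oracle `χ` and the unitary
transformation that follows them. -/
noncomputable def state (A : QueryAlgorithm Q Y) (χ : Q → Bool) : ℕ → (Q × Bool × A.W → ℂ)
  | 0 => (A.U 0 : Matrix (Q × Bool × A.W) (Q × Bool × A.W) ℂ).mulVec (Pi.single A.init 1)
  | t + 1 => (A.U (t + 1) : Matrix (Q × Bool × A.W) (Q × Bool × A.W) ℂ).mulVec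
      (applyOracle χ (A.state χ t))

/-- The probability that the algorithm, run with the oracle `χ`, outputs `y`. -/
noncomputable def outputProb [DecidableEq Y] (A : QueryAlgorithm Q Y) (χ : Q → Bool) (y : Y) : ℝ :=
  ∑ b : Q × Bool × A.W, if A.out b = y then ‖A.state χ A.queries b‖ ^ 2 else 0

end QueryAlgorithm

/-- The queries to a substring oracle: binary strings `s` of length `1 ≤ |s| ≤ N`. -/
abbrev SubstringQuery (N : ℕ) : Type :=
  {s : List Bool // 1 ≤ s.length ∧ s.length ≤ N}

noncomputable instance SubstringQuery.instFintype (N : ℕ) : Fintype (SubstringQuery N) :=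
  haveI : Finite (SubstringQuery N) :=
    ((List.finite_length_le Bool N).subset fun _ h => h.2).to_subtype
  Fintype.ofFinite _

/-- The substring oracle of the string `x`: the answer to `s` is `1` if and only if `s` occurs in
`x` as a block of consecutive letters. -/
def substringOracle {N : ℕ} (x : Fin N → Bool) (s : SubstringQuery N) : Bool :=
  decide (s.1 <:+: List.ofFn x)

/-- The algorithm, given the substring oracle of an unknown `x ∈ {0,1}^N`, outputs `x` with
certainty, whatever `x` is. -/
def IdentifiesExactly {N : ℕ} (A : QueryAlgorithm (SubstringQuery N) (Fin N → Bool)) : Prop :=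
  ∀ x : Fin N → Bool, A.outputProb (substringOracle x) x = 1

/-! Four candidates with exactly one marked can be searched with a single query and no error, so two
letters can be bought with one query whenever exactly one two-letter extension is a substring. About
`N / 2` letters are found at one query each, and the rest at two letters per query.

A substring longer than half of `x` with several right extensions has strong periodicity: if both
one-letter extensions occur, the one that breaks the least period occurs only once
(`occursOnce_append_periodBreak`). After that, right extensions are unique, so ambiguity has to be
resolved only once (`extendRight_ensures`). A substring with no right extension is a suffix, and
then left extensions are unique too (`extendLeft_ensures`).

Guesses are verified only after blocks of about `√N` steps. A failed block is unwound at a cost of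
`O(√N)`, and this happens a bounded number of times (`verifiedSteps_ensures`). Strategies of this
adaptive kind become quantum algorithms by deferring all measurements (`recordState_eq`). -/

open Matrix

/-! ### Unitary building blocks. -/

/-- A unitary matrix can be prescribed on any set of basis vectors with orthonormal images. -/
theorem exists_unitary_mulVec_single {ι κ : Type} [Fintype ι] [DecidableEq ι] [DecidableEq κ]
    (e : κ → ι) (he : Function.Injective e) (v : κ → ι → ℂ)
    (hv : ∀ j k, ∑ i, star (v j i) * v k i = if j = k then 1 else 0) :
    ∃ D : unitaryGroup ι ℂ, ∀ j, (D : Matrix ι ι ℂ) *ᵥ Pi.single (e j) 1 = v j := by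
  classical
  let u : ι → EuclideanSpace ℂ ι := fun i =>
    if h : ∃ j, e j = i then WithLp.toLp 2 (v h.choose) else 0
  have hu : ∀ j, u (e j) = WithLp.toLp 2 (v j) := by
    intro j
    have h : ∃ k, e k = e j := ⟨j, rfl⟩
    simp only [u, dif_pos h]
    rw [he h.choose_spec]
  have ho : Orthonormal ℂ ((Set.range e).domRestrict u) := by
    rw [orthonormal_iff_ite]
    rintro ⟨_, j, rfl⟩ ⟨_, k, rfl⟩
    change inner ℂ (u (e j)) (u (e k)) = _
    rw [hu, hu, PiLp.inner_apply]
    refine Eq.trans (Finset.sum_congr rfl fun i _ => ?_) ((hv j k).trans ?_)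
    · simp [mul_comm]
    · by_cases h : j = k
      · subst h
        rw [if_pos rfl, if_pos rfl]
      · rw [if_neg h, if_neg fun h' => h (he (congrArg Subtype.val h'))]
  obtain ⟨b, hb⟩ := ho.exists_orthonormalBasis_extension_of_card_eq (by simp)
  refine ⟨⟨_, (EuclideanSpace.basisFun ι ℂ).toMatrix_orthonormalBasis_mem_unitary b⟩, fun j => ?_⟩
  ext i
  simp [Module.Basis.toMatrix_apply, hb (e j) ⟨j, rfl⟩, hu]

/-- A unitary matrix preserves the sum of the squared moduli. -/
theorem sum_norm_sq_unitary_mulVec {ι : Type} [Fintype ι] [DecidableEq ι] (D : unitaryGroup ι ℂ)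
    (ψ : ι → ℂ) : ∑ i, ‖((D : Matrix ι ι ℂ) *ᵥ ψ) i‖ ^ 2 = ∑ i, ‖ψ i‖ ^ 2 := by
  have key : ∀ φ : ι → ℂ, ((∑ i, ‖φ i‖ ^ 2 : ℝ) : ℂ) = star φ ⬝ᵥ φ := by
    intro φ
    simp only [dotProduct, Pi.star_apply, RCLike.star_def, Complex.conj_mul']
    push_cast
    rfl
  have h : star (D : Matrix ι ι ℂ) * (D : Matrix ι ι ℂ) = 1 := (mem_unitaryGroup_iff').1 D.2
  apply Complex.ofReal_injective
  rw [key, key, star_mulVec, ← dotProduct_mulVec, mulVec_mulVec, ← star_eq_conjTranspose, h,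
    one_mulVec]

/-- The unitary matrix which applies `M h` to the first factor, controlled by the second one. -/
noncomputable def controlledUnitary {ι H κ : Type} [Fintype ι] [DecidableEq ι] [Fintype H]
    [DecidableEq H] [Fintype κ] [DecidableEq κ] (e : κ ≃ ι × H) (M : H → unitaryGroup ι ℂ) :
    unitaryGroup κ ℂ :=
  ⟨(blockDiagonal fun h => (M h : Matrix ι ι ℂ)).submatrix e e, by
    rw [mem_unitaryGroup_iff, star_eq_conjTranspose, conjTranspose_submatrix,
      submatrix_mul_equiv, blockDiagonal_conjTranspose, ← blockDiagonal_mul]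
    have h : (fun k => (M k : Matrix ι ι ℂ) * (M k : Matrix ι ι ℂ)ᴴ) = 1 := by
      funext k
      exact (mem_unitaryGroup_iff).1 (M k).2
    rw [h, blockDiagonal_one, submatrix_one_equiv]⟩

theorem controlledUnitary_mulVec {ι H κ : Type} [Fintype ι] [DecidableEq ι] [Fintype H]
    [DecidableEq H] [Fintype κ] [DecidableEq κ] (e : κ ≃ ι × H) (M : H → unitaryGroup ι ℂ)
    {ψ : κ → ℂ} {h : H} {c : ℂ} {v : ι → ℂ} (hψ : ∀ b, ψ (e.symm (b, h)) = c * v b) (b : ι) :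
    ((controlledUnitary e M).1 *ᵥ ψ) (e.symm (b, h)) = c * ((M h).1 *ᵥ v) b := by
  simp only [controlledUnitary, mulVec, dotProduct, submatrix_apply, Equiv.apply_symm_apply]
  rw [← e.symm.sum_comp, Fintype.sum_prod_type, Finset.mul_sum]
  simp [blockDiagonal_apply, hψ, mul_left_comm]

/-- The unitary matrix of a permutation of the basis states. -/
noncomputable def permUnitary {κ : Type} [Fintype κ] [DecidableEq κ] (σ : Equiv.Perm κ) :
    unitaryGroup κ ℂ :=
  ⟨σ.permMatrix ℂ, by
    rw [mem_unitaryGroup_iff, star_eq_conjTranspose, conjTranspose_permMatrix, ← permMatrix_mul]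
    simp⟩

theorem permUnitary_mulVec {κ : Type} [Fintype κ] [DecidableEq κ] (σ : Equiv.Perm κ)
    (ψ : κ → ℂ) (b : κ) : ((permUnitary σ : Matrix κ κ ℂ) *ᵥ ψ) b = ψ (σ b) := by
  simp [permUnitary, permMatrix_mulVec]

/-! ### Adaptive strategies and their query budgets. -/

/-- An adaptive procedure with oracle calls. `ask q` learns the answer to `q`. `search f` learns
the index of the only query of the family `f` with a positive answer; if there is no such index or
more than one, its result is arbitrary. -/
inductive Strategy (Q Y : Type) : Type
  | ret (y : Y) : Strategy Q Y
  | ask (q : Q) (k : Bool → Strategy Q Y) : Strategy Q Y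
  | search (f : Bool × Bool → Q) (k : Bool × Bool → Strategy Q Y) : Strategy Q Y

namespace Strategy

variable {Q Y Z : Type}

/-- With the oracle `χ` and `n` oracle calls available, every run of the strategy ends with
a result `y` and a number `m` of unused oracle calls for which `P m y` holds. -/
def Ensures (χ : Q → Bool) : Strategy Q Y → ℕ → (ℕ → Y → Prop) → Prop
  | ret y, n, P => P n y
  | ask q k, n, P => ∃ m, n = m + 1 ∧ Ensures χ (k (χ q)) m P
  | search f k, n, P => ∃ m, n = m + 1 ∧
      ∀ j, (∀ i, (∀ l, χ (f l) = true ↔ l = i) → j = i) → Ensures χ (k j) m P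

/-- Run a strategy and continue according to its result. -/
def bind : Strategy Q Y → (Y → Strategy Q Z) → Strategy Q Z
  | ret y, g => g y
  | ask q k, g => ask q fun a => (k a).bind g
  | search f k, g => search f fun j => (k j).bind g

theorem Ensures.bind {χ : Q → Bool} {g : Y → Strategy Q Z} {P : ℕ → Z → Prop} :
    ∀ {s : Strategy Q Y} {n : ℕ},
      s.Ensures χ n (fun m y => (g y).Ensures χ m P) → (s.bind g).Ensures χ n P
  | ret _, _, h => h
  | ask _ _, _, ⟨m, hm, h⟩ => ⟨m, hm, Ensures.bind h⟩
  | search _ _, _, ⟨m, hm, h⟩ => ⟨m, hm, fun j hj => Ensures.bind (h j hj)⟩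

theorem Ensures.mono {χ : Q → Bool} {P P' : ℕ → Y → Prop} (hP : ∀ m y, P m y → P' m y) :
    ∀ {s : Strategy Q Y} {n : ℕ}, s.Ensures χ n P → s.Ensures χ n P'
  | ret _, _, h => hP _ _ h
  | ask _ _, _, ⟨m, hm, h⟩ => ⟨m, hm, Ensures.mono hP h⟩
  | search _ _, _, ⟨m, hm, h⟩ => ⟨m, hm, fun j hj => Ensures.mono hP (h j hj)⟩

end Strategy

/-! ### Compilation of strategies into query algorithms. -/

/-- The state of the query and answer registers and a scratch register when the family `f` is
queried with amplitudes `g`, the answer register being in the state `|0⟩ - |1⟩`. -/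
def phaseVec {Q S : Type} [DecidableEq Q] (f : S → Q) (g : S → ℂ) : Q × Bool × S → ℂ :=
  fun b => if b.1 = f b.2.2 then (if b.2.1 then -1 else 1) * g b.2.2 else 0

theorem applyOracle_phaseVec {Q S : Type} [DecidableEq Q] (χ : Q → Bool) (f : S → Q)
    (g : S → ℂ) : QueryAlgorithm.applyOracle χ (phaseVec f g) =
      phaseVec f fun i => if χ (f i) then -g i else g i := by
  funext ⟨q, a, i⟩
  simp only [QueryAlgorithm.applyOracle, phaseVec]
  by_cases h : q = f i
  · subst h
    cases a <;> cases χ (f i) <;> simp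
  · simp [h]

theorem sum_star_phaseVec_mul {Q S : Type} [Fintype Q] [Fintype S] [DecidableEq Q] (f : S → Q)
    (g g' : S → ℂ) : ∑ b, star (phaseVec f g b) * phaseVec f g' b =
      2 * ∑ i, star (g i) * g' i := by
  rw [Fintype.sum_prod_type, Finset.sum_comm, Fintype.sum_prod_type, Finset.mul_sum,
    Finset.sum_comm]
  refine Finset.sum_congr rfl fun i _ => ?_
  simp only [phaseVec, Fintype.sum_bool]
  simp [apply_ite, two_mul]

section Compile

variable {Q Y : Type} [Fintype Q] [DecidableEq Q] [Inhabited Q]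

open QueryAlgorithm

/-- One oracle call between suitable unitary transformations performs one step of a strategy,
the remaining strategy being a function of the measurement result. -/
theorem Strategy.exists_step (s : Strategy Q Y) :
    ∃ (A C : unitaryGroup (Q × Bool × (Bool × Bool)) ℂ)
      (d : Q × Bool × (Bool × Bool) → Strategy Q Y),
      ∀ (χ : Q → Bool) (n : ℕ) (y : Y), s.Ensures χ (n + 1) (fun _ z => z = y) →
        ∀ b, (C.1 *ᵥ
          applyOracle χ (A.1 *ᵥ Pi.single default 1)) b ≠ 0 →
          (d b).Ensures χ n (fun _ z => z = y) := by
  cases s with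
  | ret y' => exact ⟨1, 1, fun _ => .ret y', fun χ n y h b _ => h⟩
  | ask q k =>
    refine ⟨permUnitary (Equiv.swap default (q, false, default)), 1, fun b => k b.2.1, ?_⟩
    rintro χ n y ⟨m, hm, h⟩ b hb
    obtain rfl : n = m := by omega
    have h1 : ((permUnitary (Equiv.swap default (q, false, default))).1 *ᵥ
        Pi.single (default : Q × Bool × (Bool × Bool)) (1 : ℂ)) =
        Pi.single (q, false, default) 1 := by
      funext b
      rw [permUnitary_mulVec]
      simp only [Pi.single_apply, Equiv.swap_apply_eq_iff, Equiv.swap_apply_left]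
    rw [h1, applyOracle_single] at hb
    simp only [UnitaryGroup.one_val, one_mulVec, Bool.false_xor] at hb
    have hb' : b = (q, χ q, default) := by
      by_contra hne
      exact hb (Pi.single_eq_of_ne hne 1)
    subst hb'
    exact h
  | search f k =>
    -- The superposition runs over eight basis states (four indices, two answer bits), so the
    -- amplitude is `1 / √8 = √2 / 4`.
    obtain ⟨A, hA⟩ := exists_unitary_mulVec_single
      (fun _ : Unit => (default : Q × Bool × (Bool × Bool))) (fun _ _ _ => rfl)
      (fun _ => phaseVec f fun _ => ((√2 / 4 : ℝ) : ℂ)) (by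
        intro _ _
        rw [sum_star_phaseVec_mul]
        simp only [RCLike.star_def, Complex.conj_ofReal, Finset.sum_const, Finset.card_univ,
          Fintype.card_prod, Fintype.card_bool, ← Complex.ofReal_mul]
        have : √2 / 4 * (√2 / 4) = (1 / 8 : ℝ) := by
          have := Real.mul_self_sqrt (show (0 : ℝ) ≤ 2 by norm_num)
          linarith
        rw [this]
        norm_num)
    -- Phase kickback flips the sign at the marked index. The four possible results are orthogonal:
    -- for two different indices, two of the four products are negative. Hence `star D` reads off
    -- the index with certainty.
    obtain ⟨D, hD⟩ := exists_unitary_mulVec_single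
      (fun j : Bool × Bool => ((default : Q), false, j)) (fun _ _ h => by simpa using h)
      (fun j => phaseVec f fun i => if i = j then -((√2 / 4 : ℝ) : ℂ) else ((√2 / 4 : ℝ) : ℂ)) (by
        intro j l
        rw [sum_star_phaseVec_mul]
        have : (((√2 / 4 : ℝ) : ℂ)) * ((√2 / 4 : ℝ) : ℂ) = (1 / 8 : ℂ) := by
          have h2 : √2 / 4 * (√2 / 4) = (1 / 8 : ℝ) := by
            have := Real.mul_self_sqrt (show (0 : ℝ) ≤ 2 by norm_num)
            linarith
          rw [← Complex.ofReal_mul, h2]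
          norm_num
        have hs : star ((√2 / 4 : ℝ) : ℂ) = ((√2 / 4 : ℝ) : ℂ) := Complex.conj_ofReal _
        generalize ((√2 / 4 : ℝ) : ℂ) = c at this hs
        have h3 : ∀ i : Bool × Bool, (star (if i = j then -c else c) * if i = l then -c else c) =
            if i = j then (if i = l then 1 / 8 else -1 / 8) else
              if i = l then -1 / 8 else 1 / 8 := by
          intro i
          split_ifs <;> simp only [star_neg, hs, neg_mul, mul_neg, neg_neg, this] <;> norm_num
        simp only [h3, Fintype.sum_prod_type, Fintype.sum_bool]
        rcases j with ⟨_ | _, _ | _⟩ <;> rcases l with ⟨_ | _, _ | _⟩ <;>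
          simp only [Prod.mk.injEq, reduceCtorEq, and_self, and_true, and_false, if_true, if_false] <;> norm_num)
    refine ⟨A, star D, fun b => k b.2.2, ?_⟩
    rintro χ n y ⟨m, hm, h⟩ b hb
    obtain rfl : n = m := by omega
    refine h _ fun i hi => ?_
    rw [hA (), applyOracle_phaseVec] at hb
    have h1 : (fun l => if χ (f l) then -((√2 / 4 : ℝ) : ℂ) else ((√2 / 4 : ℝ) : ℂ)) =
        fun l => if l = i then -((√2 / 4 : ℝ) : ℂ) else ((√2 / 4 : ℝ) : ℂ) := by
      funext l
      simp only [hi l]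
    have h2 : star D.1 * D.1 = 1 := (mem_unitaryGroup_iff').1 D.2
    rw [h1, ← hD i, mulVec_mulVec, show (star D).1 * D.1 = 1 from h2, one_mulVec] at hb
    have hb' : b = (default, false, i) := by
      by_contra hne
      exact hb (Pi.single_eq_of_ne hne 1)
    rw [hb']

namespace Strategy

/-- The unitary transformation before the oracle call of a step. -/
noncomputable def stepBefore (s : Strategy Q Y) : unitaryGroup (Q × Bool × (Bool × Bool)) ℂ :=
  s.exists_step.choose

/-- The unitary transformation after the oracle call of a step. -/
noncomputable def stepAfter (s : Strategy Q Y) : unitaryGroup (Q × Bool × (Bool × Bool)) ℂ :=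
  s.exists_step.choose_spec.choose

/-- The remaining strategy after a step with a given measurement result. -/
noncomputable def stepRest (s : Strategy Q Y) : Q × Bool × (Bool × Bool) → Strategy Q Y :=
  s.exists_step.choose_spec.choose_spec.choose

theorem stepRest_ensures (s : Strategy Q Y) {χ : Q → Bool} {n : ℕ} {y : Y}
    (h : s.Ensures χ (n + 1) (fun _ z => z = y)) {b : Q × Bool × (Bool × Bool)}
    (hb : (s.stepAfter.1 *ᵥ
      applyOracle χ (s.stepBefore.1 *ᵥ Pi.single default 1)) b ≠ 0) :
    (s.stepRest b).Ensures χ n (fun _ z => z = y) :=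
  s.exists_step.choose_spec.choose_spec.choose_spec χ n y h b hb

/-- The remaining strategy after `t` steps with the measurement results `h`. -/
noncomputable def restAfter {T : ℕ} (s : Strategy Q Y) (h : Fin T → Q × Bool × (Bool × Bool)) :
    ℕ → Strategy Q Y
  | 0 => s
  | t + 1 => (s.restAfter h t).stepRest (if ht : t < T then h ⟨t, ht⟩ else default)

theorem restAfter_update {T : ℕ} (s : Strategy Q Y) (h : Fin T → Q × Bool × (Bool × Bool))
    (i : Fin T) (b : Q × Bool × (Bool × Bool)) :
    ∀ t ≤ i.1, s.restAfter (Function.update h i b) t = s.restAfter h t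
  | 0, _ => rfl
  | t + 1, ht => by
    simp only [restAfter, restAfter_update s h i b t (by omega)]
    congr 1
    split
    · rw [Function.update_of_ne]
      rintro rfl
      simp at ht
    · rfl

/-- The separation of the first three registers from the record of measurement results. -/
def splitRecord (B H : Type) : Q × Bool × (B × H) ≃ (Q × Bool × B) × H where
  toFun b := ((b.1, b.2.1, b.2.2.1), b.2.2.2)
  invFun b := (b.1.1, b.1.2.1, b.1.2.2, b.2)

/-- Exchange the first factor with the `i`-th entry of the second one. -/
def swapEntry {B : Type} {T : ℕ} (i : Fin T) : Equiv.Perm (B × (Fin T → B)) :=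
  Function.Involutive.toPerm (fun p => (p.2 i, Function.update p.2 i p.1)) fun p => by simp

instance instDecidableEqRecord (T : ℕ) : DecidableEq (Fin T → Q × Bool × (Bool × Bool)) :=
  inferInstance

/-- The unitary transformations of the query algorithm which runs a strategy and records all the
measurement results. -/
noncomputable def recordUnitary (s : Strategy Q Y) (T : ℕ) :
    ℕ → unitaryGroup (Q × Bool × ((Bool × Bool) × (Fin T → Q × Bool × (Bool × Bool)))) ℂ
  | 0 => controlledUnitary (splitRecord _ _) fun h => (s.restAfter h 0).stepBefore
  | t + 1 =>
    -- The rightmost factor acts first: step `t` is finished, its result is exchanged with the still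
    -- blank entry `t` of the record, and step `t + 1` starts on the blank registers.
    controlledUnitary (splitRecord _ _) (fun h => (s.restAfter h (t + 1)).stepBefore) *
    ((if ht : t < T then permUnitary
      (((splitRecord _ _).trans (swapEntry ⟨t, ht⟩)).trans (splitRecord _ _).symm) else 1) *
    controlledUnitary (splitRecord _ _) fun h => (s.restAfter h t).stepAfter)

/-- The query algorithm which runs a strategy with `T` oracle calls, recording all the
measurement results. -/
noncomputable def toQueryAlgorithm [Inhabited Y] (s : Strategy Q Y) (T : ℕ) :
    QueryAlgorithm Q Y where
  W := (Bool × Bool) × (Fin T → Q × Bool × (Bool × Bool))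
  queries := T
  init := (splitRecord _ _).symm (default, fun _ => default)
  U := s.recordUnitary T
  out b := match s.restAfter b.2.2.2 T with
    | ret y => y
    | _ => default

/-- The states of `toQueryAlgorithm`. -/
noncomputable def recordState (s : Strategy Q Y) (T : ℕ) (χ : Q → Bool) :
    ℕ → Q × Bool × ((Bool × Bool) × (Fin T → Q × Bool × (Bool × Bool))) → ℂ
  | 0 => (s.recordUnitary T 0).1 *ᵥ Pi.single ((splitRecord _ _).symm (default, fun _ => default)) 1
  | t + 1 => (s.recordUnitary T (t + 1)).1 *ᵥ applyOracle χ (s.recordState T χ t)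

theorem state_toQueryAlgorithm [Inhabited Y] (s : Strategy Q Y) (T : ℕ) (χ : Q → Bool) :
    ∀ t, (s.toQueryAlgorithm T).state χ t = s.recordState T χ t
  | 0 => rfl
  | t + 1 => congrArg (fun ψ => (s.recordUnitary T (t + 1)).1 *ᵥ applyOracle χ ψ)
      (s.state_toQueryAlgorithm T χ t)

/-- The amplitudes of the measurement results of the first step. -/
noncomputable def stepAmplitude (s : Strategy Q Y) (χ : Q → Bool) :
    Q × Bool × (Bool × Bool) → ℂ :=
  s.stepAfter.1 *ᵥ applyOracle χ (s.stepBefore.1 *ᵥ Pi.single default 1)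

/-- Invariant of the deferred measurements: on each record the working registers hold the freshly
prepared state of the next step, and records of nonzero amplitude leave a strategy that still
succeeds. Blank later entries are what makes the exchange reset the registers. -/
theorem recordState_eq (s : Strategy Q Y) (T : ℕ) (χ : Q → Bool) (y : Y)
    (hs : s.Ensures χ T (fun _ z => z = y)) (t : ℕ) (ht : t ≤ T) :
    ∃ α : (Fin T → Q × Bool × (Bool × Bool)) → ℂ,
      (∀ b h, s.recordState T χ t ((splitRecord _ _).symm (b, h)) =
        α h * ((s.restAfter h t).stepBefore.1 *ᵥ Pi.single default 1) b) ∧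
      ∀ h, α h ≠ 0 → (s.restAfter h t).Ensures χ (T - t) (fun _ z => z = y) ∧
        ∀ i : Fin T, t ≤ i.1 → h i = default := by
  induction t with
  | zero =>
    refine ⟨fun h => if h = fun _ => default then 1 else 0, fun b h => ?_, fun h hh => ?_⟩
    · refine controlledUnitary_mulVec (splitRecord _ _)
        (fun h => (s.restAfter h 0).stepBefore) (fun b' => ?_) b
      simp only [Pi.single_apply, Equiv.apply_eq_iff_eq, Prod.mk.injEq]
      by_cases h1 : h = fun _ => default <;> simp [h1]
    · have hh' : h = fun _ => default := by
        by_contra hne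
        simp [hne] at hh
      exact ⟨hs, fun i _ => by rw [hh']⟩
  | succ t ih =>
    obtain ⟨α, hα, hsupp⟩ := ih (by omega)
    have htT : t < T := ht
    let i : Fin T := ⟨t, htT⟩
    refine ⟨fun h => α (Function.update h i default) *
      (s.restAfter h t).stepAmplitude χ (h i), fun b h => ?_, fun h hh => ?_⟩
    · have h1 : ∀ b h, ((controlledUnitary (splitRecord _ _)
          (fun h => (s.restAfter h t).stepAfter)).1 *ᵥ applyOracle χ (s.recordState T χ t))
          ((splitRecord _ _).symm (b, h)) = α h * (s.restAfter h t).stepAmplitude χ b :=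
        fun b h => controlledUnitary_mulVec (splitRecord _ _)
          (fun h => (s.restAfter h t).stepAfter)
          (fun b' => hα (b'.1, xor b'.2.1 (χ b'.1), b'.2.2) h) b
      have h2 : ∀ b h, α (Function.update h i b) *
          (s.restAfter (Function.update h i b) t).stepAmplitude χ (h i) =
          α (Function.update h i default) * (s.restAfter h t).stepAmplitude χ (h i) *
            (Pi.single default 1 : Q × Bool × (Bool × Bool) → ℂ) b := by
        intro b h
        rw [restAfter_update s h i b t le_rfl, Pi.single_apply]
        split_ifs with hb
        · rw [hb, mul_one]
        · rw [mul_zero]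
          by_contra hne
          apply hb
          have := (hsupp _ (left_ne_zero_of_mul hne)).2 i le_rfl
          simpa using this
      rw [recordState, recordUnitary, dif_pos htT, UnitaryGroup.mul_val, UnitaryGroup.mul_val,
        ← mulVec_mulVec, ← mulVec_mulVec]
      refine controlledUnitary_mulVec (splitRecord _ _)
        (fun h => (s.restAfter h (t + 1)).stepBefore) (fun b' => ?_) b
      rw [permUnitary_mulVec]
      exact (h1 (h i) (Function.update h i b')).trans (h2 b' h)
    · have hα' := hsupp _ (left_ne_zero_of_mul hh)
      rw [restAfter_update s h i default t le_rfl] at hα'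
      refine ⟨?_, fun l hl => ?_⟩
      · simp only [restAfter, dif_pos htT]
        refine stepRest_ensures _ ?_ (right_ne_zero_of_mul hh)
        convert hα'.1 using 1
        omega
      · have := hα'.2 l (by omega)
        rwa [Function.update_of_ne] at this
        rintro rfl
        simp [i] at hl

end Strategy

omit [Inhabited Q] in
theorem QueryAlgorithm.sum_norm_sq_state (A : QueryAlgorithm Q Y) (χ : Q → Bool) (t : ℕ) :
    ∑ b, ‖A.state χ t b‖ ^ 2 = 1 := by
  induction t with
  | zero =>
    simp only [state, sum_norm_sq_unitary_mulVec]
    rw [Finset.sum_eq_single A.init] <;> simp +contextual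
  | succ t ih =>
    simp only [state, sum_norm_sq_unitary_mulVec]
    rw [← ih]
    refine Function.Bijective.sum_comp (g := fun b => ‖A.state χ t b‖ ^ 2)
      (e := fun b => (b.1, xor b.2.1 (χ b.1), b.2.2)) (Function.Involutive.bijective ?_)
    rintro ⟨q, a, w⟩
    simp

/-- Every basis state of nonzero final amplitude yields `y`, so the probability is the full squared
norm. -/
theorem Strategy.outputProb_toQueryAlgorithm [Inhabited Y] [DecidableEq Y] (s : Strategy Q Y)
    (T : ℕ) (χ : Q → Bool) (y : Y) (hs : s.Ensures χ T (fun _ z => z = y)) :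
    (s.toQueryAlgorithm T).outputProb χ y = 1 := by
  rw [← (s.toQueryAlgorithm T).sum_norm_sq_state χ T]
  refine Finset.sum_congr rfl fun b _ => ?_
  split_ifs with hb
  · rfl
  · obtain ⟨α, hα, hsupp⟩ := s.recordState_eq T χ y hs T le_rfl
    by_contra hne
    apply hb
    have h1 := hα (b.1, b.2.1, b.2.2.1) b.2.2.2
    have h2 : α b.2.2.2 ≠ 0 := by
      intro h0
      rw [h0, zero_mul] at h1
      apply hne
      have h3 : (s.toQueryAlgorithm T).state χ T b = 0 :=
        (congrFun (s.state_toQueryAlgorithm T χ T) b).trans h1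
      rw [h3]
      simp
    have h3 := (hsupp _ h2).1
    -- With no calls left, only `ret` can satisfy `Ensures`.
    rw [Nat.sub_self] at h3
    change (match s.restAfter b.2.2.2 T with
      | ret y => y
      | _ => default) = y
    revert h3
    cases s.restAfter b.2.2.2 T with
    | ret y' => exact fun h => h
    | ask q k => rintro ⟨m, hm, _⟩; omega
    | search f k => rintro ⟨m, hm, _⟩; omega

end Compile

/-! ### Occurrences and periods of strings. -/

/-- The string `s` occurs in `x` at position `i`. -/
def OccursAt (x s : List Bool) (i : ℕ) : Prop :=
  i + s.length ≤ x.length ∧ ∀ k < s.length, x[i + k]? = s[k]?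

theorem isInfix_iff_exists_occursAt {x s : List Bool} : s <:+: x ↔ ∃ i, OccursAt x s i := by
  rw [List.infix_iff_getElem?]
  refine exists_congr fun i => and_congr (by rw [add_comm]) (forall₂_congr fun k hk => ?_)
  rw [List.getElem?_eq_getElem hk, add_comm]

theorem OccursAt.of_append_left {x s t : List Bool} {i : ℕ} (h : OccursAt x (s ++ t) i) :
    OccursAt x s i := by
  obtain ⟨h1, h2⟩ := h
  rw [List.length_append] at h1 h2
  refine ⟨by omega, fun k hk => ?_⟩
  rw [h2 k (by omega), List.getElem?_append_left hk]

theorem OccursAt.of_append_right {x s t : List Bool} {i : ℕ} (h : OccursAt x (s ++ t) i) :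
    OccursAt x t (i + s.length) := by
  obtain ⟨h1, h2⟩ := h
  rw [List.length_append] at h1 h2
  refine ⟨by omega, fun k hk => ?_⟩
  rw [add_assoc, h2 _ (by omega), List.getElem?_append_right (by omega), Nat.add_sub_cancel_left]

/-- The string `s` occurs at most once in `x`. -/
def OccursOnce (x s : List Bool) : Prop :=
  ∀ i j, OccursAt x s i → OccursAt x s j → i = j

theorem OccursOnce.of_isPrefix {x s t : List Bool} (h : OccursOnce x s) (hst : s <+: t) :
    OccursOnce x t := by
  obtain ⟨t, rfl⟩ := hst
  exact fun i j hi hj => h i j hi.of_append_left hj.of_append_left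

/-- A string occurring only once has only one right extension of any given length. -/
theorem OccursOnce.append_right_unique {x s t t' : List Bool} (h : OccursOnce x s)
    (ht : s ++ t <:+: x) (ht' : s ++ t' <:+: x) (hl : t.length = t'.length) : t = t' := by
  obtain ⟨i, hi⟩ := isInfix_iff_exists_occursAt.1 ht
  obtain ⟨j, hj⟩ := isInfix_iff_exists_occursAt.1 ht'
  obtain rfl := h i j hi.of_append_left hj.of_append_left
  refine List.ext_getElem? fun k => ?_
  rcases lt_or_ge k t.length with hk | hk
  · rw [← hi.of_append_right.2 k hk, hj.of_append_right.2 k (hl ▸ hk)]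
  · rw [List.getElem?_eq_none hk, List.getElem?_eq_none (hl ▸ hk)]

/-- The string `u` has period `d`. -/
def IsPeriod (u : List Bool) (d : ℕ) : Prop :=
  ∀ k, k + d < u.length → u[k + d]? = u[k]?

theorem OccursAt.isPeriod {x u : List Bool} {i j : ℕ} (hi : OccursAt x u i) (hj : OccursAt x u j)
    (hij : i ≤ j) : IsPeriod u (j - i) := by
  intro k hk
  rw [← hi.2 _ hk, ← hj.2 k (by omega)]
  congr 1
  omega

/-- Move by `d` one way and by `p` the other, choosing the order that stays inside `u`. This is the
Euclidean step behind `leastPeriod_dvd`. -/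
theorem IsPeriod.sub {u : List Bool} {p d : ℕ} (hp : IsPeriod u p) (hd : IsPeriod u d)
    (hpd : p ≤ d) (h : p + d ≤ u.length) : IsPeriod u (d - p) := by
  intro k hk
  rcases lt_or_ge k p with hkp | hkp
  · rw [← hd k (by omega), ← hp (k + (d - p)) (by omega)]
    congr 1
    omega
  · have h1 := hd (k - p) (by omega)
    have h2 := hp (k - p) (by omega)
    rw [show k - p + d = k + (d - p) by omega] at h1
    rw [show k - p + p = k by omega] at h2
    rw [h1, h2]

theorem IsPeriod.mul {u : List Bool} {p : ℕ} (hp : IsPeriod u p) (m : ℕ) :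
    IsPeriod u (p * m) := by
  induction m with
  | zero => exact fun k _ => rfl
  | succ m ih =>
    intro k hk
    rw [Nat.mul_succ] at hk ⊢
    rw [← add_assoc, hp _ (by omega), ih _ (by omega)]

/-- The least positive period of a string. -/
noncomputable def leastPeriod (u : List Bool) : ℕ :=
  sInf {p | 0 < p ∧ IsPeriod u p}

theorem leastPeriod_spec {u : List Bool} (hu : u ≠ []) :
    0 < leastPeriod u ∧ IsPeriod u (leastPeriod u) :=
  Nat.sInf_mem (s := {p | 0 < p ∧ IsPeriod u p})
    ⟨u.length, List.length_pos_iff.2 hu, fun k hk => by omega⟩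

theorem leastPeriod_le {u : List Bool} {d : ℕ} (hd : 0 < d) (h : IsPeriod u d) :
    leastPeriod u ≤ d :=
  Nat.sInf_le ⟨hd, h⟩

/-- A form of the theorem of Fine and Wilf. -/
theorem leastPeriod_dvd {u : List Bool} (hu : u ≠ []) (d : ℕ) (hd : IsPeriod u d)
    (h : leastPeriod u + d ≤ u.length) : leastPeriod u ∣ d := by
  induction d using Nat.strong_induction_on with
  | _ d ih =>
    obtain ⟨hp, hp'⟩ := leastPeriod_spec hu
    rcases Nat.eq_zero_or_pos d with rfl | hpos
    · exact dvd_zero _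
    · have hle := leastPeriod_le hpos hd
      have := ih (d - leastPeriod u) (by omega) (hp'.sub hd hle h) (by omega)
      rwa [Nat.dvd_sub_iff_left hle (dvd_refl _)] at this

/-- The letter which, appended to `u`, breaks its least period. -/
noncomputable def periodBreak (u : List Bool) : Bool :=
  !(u.getD (u.length - leastPeriod u) false)

/-- If a string longer than half of `x` has both one-letter extensions, then the extension which
breaks the least period occurs only once. -/
theorem occursOnce_append_periodBreak {x u : List Bool} (hx : x.length < 2 * u.length)
    (h : u ++ [!periodBreak u] <:+: x) : OccursOnce x (u ++ [periodBreak u]) := by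
  have hu : u ≠ [] := by
    rintro rfl
    simp at hx
  obtain ⟨hp, hp'⟩ := leastPeriod_spec hu
  obtain ⟨k, hk⟩ := isInfix_iff_exists_occursAt.1 h
  have hnext : ∀ {c : Bool} {i : ℕ}, OccursAt x (u ++ [c]) i →
      x[i + u.length]? = some c ∧ i + u.length + 1 ≤ x.length := by
    intro c i hi
    have h1 := hi.of_append_right.2 0 (by simp)
    have h2 := hi.1
    rw [List.length_append, List.length_singleton] at h2
    exact ⟨by simpa using h1, by omega⟩
  have main : ∀ i j, OccursAt x (u ++ [periodBreak u]) i → OccursAt x (u ++ [periodBreak u]) j →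
      ¬ i < j := by
    intro i j hi hj hij
    obtain ⟨hi1, hi2⟩ := hnext hi
    obtain ⟨hj1, hj2⟩ := hnext hj
    obtain ⟨hk1, hk2⟩ := hnext hk
    have hki : k ≠ i := by
      rintro rfl
      simp [hi1] at hk1
    have hkj : k ≠ j := by
      rintro rfl
      simp [hj1] at hk1
    have hiu := hi.of_append_left
    have hju := hj.of_append_left
    have hku := hk.of_append_left
    -- The three occurrences of `u` at `i`, `j`, `k` start within a span of at most `u.length`. Any
    -- gap is a period and bounds the least period, so an adjacent gap leaves enough room for Fine
    -- and Wilf.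
    have hdvd : leastPeriod u ∣ j - i := by
      rcases lt_or_gt_of_ne hki with hki | hki
      · have := leastPeriod_le (by omega) (hku.isPeriod hiu hki.le)
        exact leastPeriod_dvd hu _ (hiu.isPeriod hju hij.le) (by omega)
      · rcases lt_or_gt_of_ne hkj with hkj | hkj
        · have h1 := leastPeriod_le (by omega) (hku.isPeriod hju hkj.le)
          have h2 := leastPeriod_le (by omega) (hiu.isPeriod hku hki.le)
          have h3 := leastPeriod_dvd hu _ (hku.isPeriod hju hkj.le) (by omega)
          have h4 := leastPeriod_dvd hu _ (hiu.isPeriod hku hki.le) (by omega)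
          have := dvd_add h3 h4
          rwa [show j - k + (k - i) = j - i by omega] at this
        · have := leastPeriod_le (by omega) (hju.isPeriod hku hkj.le)
          exact leastPeriod_dvd hu _ (hiu.isPeriod hju hij.le) (by omega)
    obtain ⟨m, hm⟩ := hdvd
    obtain _ | m := m
    · omega
    -- The letter following the occurrence at `i` lies inside the one at `j`; by periodicity it
    -- continues the least period instead of breaking it.
    have h1 := hju.2 (u.length - (j - i)) (by omega)
    rw [show j + (u.length - (j - i)) = i + u.length by omega, hi1] at h1
    have hm' : leastPeriod u * (m + 1) = leastPeriod u * m + leastPeriod u := Nat.mul_succ _ _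
    have h2 := hp'.mul m (u.length - (j - i)) (by omega)
    rw [show u.length - (j - i) + leastPeriod u * m = u.length - leastPeriod u by omega,
      ← h1] at h2
    have h3 : u.getD (u.length - leastPeriod u) false = periodBreak u := by
      rw [List.getD_eq_getElem?_getD, h2]
      rfl
    rw [periodBreak] at h3
    simp at h3
  intro i j hi hj
  exact le_antisymm (not_lt.1 (main j i hj hi)) (not_lt.1 (main i j hi hj))

/-- A substring of `x` without right extension is a suffix of `x`. -/
theorem isSuffix_of_forall_not_isInfix {x s : List Bool} (h : s <:+: x)
    (hs : ∀ c, ¬ s ++ [c] <:+: x) : s <:+ x := by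
  obtain ⟨l, r, rfl⟩ := h
  cases r with
  | nil => exact ⟨l, by simp⟩
  | cons c r => exact absurd ⟨l, r, by simp⟩ (hs c)

theorem not_isInfix_of_length_lt {x s : List Bool} (h : x.length < s.length) : ¬ s <:+: x :=
  fun h' => absurd h'.length_le (by omega)

/-! ### The identification strategy and its query count. -/

namespace SubstringQuery

open Strategy

/-- Ask whether `s` is a substring; no query is made if `s` is empty or too long. -/
def askString (N : ℕ) (s : List Bool) : Strategy (SubstringQuery N) Bool :=
  if h : 1 ≤ s.length ∧ s.length ≤ N then .ask ⟨s, h⟩ .ret else .ret s.isEmpty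

theorem askString_ensures {N : ℕ} (x : Fin N → Bool) {s : List Bool} {n : ℕ}
    {P : ℕ → Bool → Prop} (hP : ∀ m ≥ n, ∀ a, (a = true ↔ s <:+: List.ofFn x) → P m a) :
    (askString N s).Ensures (substringOracle x) (n + 1) P := by
  unfold askString
  split_ifs with h
  · exact ⟨n, rfl, hP n le_rfl _ (by simp [substringOracle])⟩
  · refine hP _ (by omega) _ ?_
    rcases Nat.eq_zero_or_pos s.length with h0 | h0
    · obtain rfl := List.length_eq_zero_iff.1 h0
      simp
    · have h1 : ¬ s <:+: List.ofFn x := not_isInfix_of_length_lt (by rw [List.length_ofFn]; omega)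
      have h2 : s ≠ [] := List.length_pos_iff.1 h0
      simp [h1, h2]

/-- Search for the only substring in a family of four strings; no query is made if one of them is
empty or too long. -/
def searchString (N : ℕ) (f : Bool × Bool → List Bool) :
    Strategy (SubstringQuery N) (Bool × Bool) :=
  if h : ∀ i, 1 ≤ (f i).length ∧ (f i).length ≤ N then .search (fun i => ⟨f i, h i⟩) .ret
  else .ret default

theorem searchString_ensures {N : ℕ} (x : Fin N → Bool) {f : Bool × Bool → List Bool} {l : ℕ}
    (hl : 1 ≤ l) (hf : ∀ i, (f i).length = l) {n : ℕ} {P : ℕ → Bool × Bool → Prop}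
    (hP : ∀ m ≥ n, ∀ j, (∀ i, (∀ k, f k <:+: List.ofFn x ↔ k = i) → j = i) → P m j) :
    (searchString N f).Ensures (substringOracle x) (n + 1) P := by
  unfold searchString
  split_ifs with h
  · exact ⟨n, rfl, fun j hj => hP n le_rfl j fun i hi => hj i fun k => by
      simp [substringOracle, hi k]⟩
  · refine hP _ (by omega) _ fun i hi => ?_
    have hlN : N < l := by
      by_contra hlt
      exact h fun i => by rw [hf i]; omega
    exact absurd ((hi i).2 rfl)
      (not_isInfix_of_length_lt (by rw [List.length_ofFn, hf i]; exact hlN))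

/-- Extend `s` by `k` steps without verification and then find the last of the strings obtained on
the way which is a substring. The result is this string, if any, with the information
whether it is the one obtained after all the steps. -/
def verifiedSteps {N : ℕ} (step : List Bool → Strategy (SubstringQuery N) (List Bool)) :
    ℕ → List Bool → Strategy (SubstringQuery N) (Option (List Bool × Bool))
  | 0, s => (askString N s).bind fun a => .ret (if a then some (s, true) else none)
  | k + 1, s => (step s).bind fun t => (verifiedSteps step k t).bind fun r =>
      match r with
      | some y => .ret (some y)
      | none => (askString N s).bind fun a => .ret (if a then some (s, false) else none)

/-- `Bad s` is the only excuse for a step from a substring `s` to fail. Success spends `k + 1`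
queries; unwinding spends up to `k` more. -/
theorem verifiedSteps_ensures {N : ℕ} (x : Fin N → Bool)
    {step : List Bool → Strategy (SubstringQuery N) (List Bool)} {d : ℕ}
    {Bad : List Bool → Prop}
    (hstep : ∀ s n (P : ℕ → List Bool → Prop),
      (∀ m ≥ n, ∀ t, t.length = s.length + d → s <+: t →
        (¬ t <:+: List.ofFn x → Bad s) → P m t) →
      (step s).Ensures (substringOracle x) (n + 1) P)
    (k : ℕ) (s : List Bool) (n : ℕ) (P : ℕ → Option (List Bool × Bool) → Prop)
    (hnone : ¬ s <:+: List.ofFn x → ∀ m ≥ n, P m none)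
    (htrue : ∀ t, s <+: t → t.length = s.length + d * k → t <:+: List.ofFn x →
      ∀ m ≥ n + k, P m (some (t, true)))
    (hfalse : ∀ t, s <+: t → t <:+: List.ofFn x → Bad t → ∀ m ≥ n, P m (some (t, false))) :
    (verifiedSteps step k s).Ensures (substringOracle x) (n + 2 * k + 1) P := by
  induction k generalizing s n P with
  | zero =>
    refine (askString_ensures x fun m hm a ha => ?_).bind
    by_cases hs : s <:+: List.ofFn x
    · simp only [ha.2 hs]
      exact htrue s (List.prefix_refl s) rfl hs m hm
    · obtain rfl : a = false := by
        rw [← Bool.not_eq_true, ha]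
        exact hs
      exact hnone hs m hm
  | succ k ih =>
    refine (hstep s (n + 2 * k + 2) _ fun m hm t ht hst hbad => ?_).bind
    refine Ensures.bind ?_
    -- One query is reserved for testing `s` itself on the way back.
    obtain ⟨n', rfl⟩ : ∃ n', m = (n + 1 + n') + 2 * k + 1 := ⟨m - (n + 2 * k + 2), by omega⟩
    refine ih t (n + 1 + n') _ (fun hti m hm => ?_) (fun u htu hu hui m hm => ?_)
      (fun u htu hui hub m hm => ?_)
    · obtain ⟨m, rfl⟩ : ∃ m', m = m' + 1 := ⟨m - 1, by omega⟩
      refine (askString_ensures x fun m' hm' a ha => ?_).bind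
      by_cases hs : s <:+: List.ofFn x
      · simp only [ha.2 hs]
        exact hfalse s (List.prefix_refl s) hs (hbad hti) m' (by omega)
      · obtain rfl : a = false := by
          rw [← Bool.not_eq_true, ha]
          exact hs
        exact hnone hs m' (by omega)
    · exact htrue u (hst.trans htu) (by rw [hu, ht]; ring) hui m (by omega)
    · exact hfalse u (hst.trans htu) hui hub m (by omega)

/-- Extend `s` to the right by the letter `0` if this gives a substring, and by `1` otherwise. -/
def guessLetter (N : ℕ) (s : List Bool) : Strategy (SubstringQuery N) (List Bool) :=
  (askString N (s ++ [false])).bind fun a => .ret (s ++ [!a])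

theorem guessLetter_ensures {N : ℕ} (x : Fin N → Bool) (s : List Bool) (n : ℕ)
    (P : ℕ → List Bool → Prop)
    (hP : ∀ m ≥ n, ∀ t, t.length = s.length + 1 → s <+: t →
      (¬ t <:+: List.ofFn x → ∀ c, ¬ s ++ [c] <:+: List.ofFn x) → P m t) :
    (guessLetter N s).Ensures (substringOracle x) (n + 1) P := by
  refine (askString_ensures x fun m hm a ha => ?_).bind
  refine hP m hm _ (by simp) (List.prefix_append _ _) fun h c => ?_
  cases a
  · cases c
    · simpa using ha
    · exact h
  · exact absurd (ha.1 rfl) h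

/-- Extend `s` to the right by the result of a search for the next two letters. -/
def searchRight (N : ℕ) (s : List Bool) : Strategy (SubstringQuery N) (List Bool) :=
  (searchString N fun l => s ++ [l.1, l.2]).bind fun l => .ret (s ++ [l.1, l.2])

theorem searchRight_ensures {N : ℕ} (x : Fin N → Bool) (s : List Bool) (n : ℕ)
    (P : ℕ → List Bool → Prop)
    (hP : ∀ m ≥ n, ∀ t, t.length = s.length + 2 → s <+: t →
      (¬ t <:+: List.ofFn x →
        ¬ ∃ i : Bool × Bool, ∀ l : Bool × Bool, s ++ [l.1, l.2] <:+: List.ofFn x ↔ l = i) →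
      P m t) :
    (searchRight N s).Ensures (substringOracle x) (n + 1) P := by
  refine (searchString_ensures x (l := s.length + 2) (by omega) (fun i => by simp)
    fun m hm j hj => ?_).bind
  refine hP m hm _ (by simp) (List.prefix_append _ _) fun h => ?_
  rintro ⟨i, hi⟩
  exact h ((hi j).2 (hj i hi))

/-- Find a right extension of `s` by one letter which is a substring, preferring the one that
breaks the least period. -/
noncomputable def carefulLetter (N : ℕ) (s : List Bool) :
    Strategy (SubstringQuery N) (Option (List Bool)) :=
  (askString N (s ++ [periodBreak s])).bind fun a =>
    (askString N (s ++ [!periodBreak s])).bind fun b =>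
      .ret (if a then some (s ++ [periodBreak s]) else
        if b then some (s ++ [!periodBreak s]) else none)

theorem carefulLetter_ensures {N : ℕ} (x : Fin N → Bool) {s : List Bool}
    (hs : N < 2 * s.length) {n : ℕ} {P : ℕ → Option (List Bool) → Prop}
    (hnone : (∀ c, ¬ s ++ [c] <:+: List.ofFn x) → ∀ m ≥ n, P m none)
    (hsome : ∀ c, s ++ [c] <:+: List.ofFn x →
      (OccursOnce (List.ofFn x) (s ++ [c]) ∨ ¬ s ++ [!c] <:+: List.ofFn x) →
      ∀ m ≥ n, P m (some (s ++ [c]))) :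
    (carefulLetter N s).Ensures (substringOracle x) (n + 2) P := by
  refine (askString_ensures x (n := n + 1) fun m hm a ha => ?_).bind
  obtain ⟨m, rfl⟩ : ∃ m', m = m' + 1 := ⟨m - 1, by omega⟩
  refine (askString_ensures x fun m' hm' b hb => ?_).bind
  cases a
  · cases b
    · refine hnone (fun c => ?_) m' (by omega)
      rcases Bool.eq_or_eq_not c (periodBreak s) with rfl | rfl
      · simpa using ha
      · simpa using hb
    · refine hsome _ (hb.1 rfl) (Or.inr ?_) m' (by omega)
      simpa using ha
  · refine hsome _ (ha.1 rfl) ?_ m' (by omega)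
    by_cases h : s ++ [!periodBreak s] <:+: List.ofFn x
    · exact Or.inl (occursOnce_append_periodBreak (by rwa [List.length_ofFn]) h)
    · exact Or.inr h

/-- Extend `s` to the right, in at most `f` rounds with `b` letters each, until its length is at
least `L` or it is found to have no right extension. -/
def findLongSubstring (N b L : ℕ) :
    ℕ → List Bool → Strategy (SubstringQuery N) (List Bool × Bool)
  | 0, s => .ret (s, false)
  | f + 1, s =>
    if L ≤ s.length then .ret (s, false) else
      (verifiedSteps (guessLetter N) b s).bind fun r =>
        match r with
        | none => .ret (s, false)
        | some (t, true) => findLongSubstring N b L f t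
        | some (t, false) => .ret (t, true)

/-- The potential is `2 * n + 2 * s.length`: a full round trades `b + 1` queries for `b` letters and
loses 2. A failed round costs at most `2 * b + 1` queries and ends the search, because a wrong guess
means there is no right extension. -/
theorem findLongSubstring_ensures {N : ℕ} (x : Fin N → Bool) (b L K f : ℕ) (s : List Bool)
    (n : ℕ) (hs : s <:+: List.ofFn x) (hsL : s.length ≤ L + b) (hf : L ≤ s.length + b * f)
    (hn : N + (L + b) + K + 2 * f + (4 * b + 2) ≤ 2 * n + 2 * s.length) :
    (findLongSubstring N b L f s).Ensures (substringOracle x) n fun m z =>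
      z.1 <:+: List.ofFn x ∧ N + K ≤ 2 * m + z.1.length ∧
        (z.2 = true → ∀ c, ¬ z.1 ++ [c] <:+: List.ofFn x) ∧ (z.2 = false → L ≤ z.1.length) := by
  induction f generalizing s n with
  | zero => exact ⟨hs, by dsimp only; omega, by simp, fun _ => by simpa using hf⟩
  | succ f ih =>
    unfold findLongSubstring
    have hsN := hs.length_le
    rw [List.length_ofFn] at hsN
    split_ifs with hL
    · exact ⟨hs, by dsimp only; omega, by simp, fun _ => hL⟩
    · obtain ⟨n, rfl⟩ : ∃ n', n = n' + 2 * b + 1 := ⟨n - (2 * b + 1), by omega⟩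
      refine (verifiedSteps_ensures x (guessLetter_ensures x) b s n _ (fun h => absurd hs h)
        (fun t hst hl ht m hm => ?_) (fun t hst ht hend m hm => ?_)).bind
      · rw [Nat.mul_succ] at hf
        exact ih t m ht (by omega) (by omega) (by omega)
      · have := hst.length_le
        exact ⟨ht, by dsimp only; omega, fun _ => hend, by simp⟩

/-- Extend `s`, which is longer than half of the unknown string, to the right as far as possible,
in at most `f` rounds with `b` searches each. -/
noncomputable def extendRight (N b : ℕ) :
    ℕ → List Bool → Strategy (SubstringQuery N) (List Bool)
  | 0, s => .ret s
  | f + 1, s => (verifiedSteps (searchRight N) b s).bind fun r =>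
      match r with
      | none => .ret s
      | some (t, true) => extendRight N b f t
      | some (t, false) => (carefulLetter N t).bind fun r =>
          match r with
          | none => .ret t
          | some u => (carefulLetter N u).bind fun r =>
              match r with
              | none => .ret u
              | some v => extendRight N b f v

/-- Here `r` counts the ambiguities still possible. The potential is `2 * n + s.length`: a full
round trades `b + 1` queries for `2 * b` letters and loses 2. A failed round with its careful
letters costs at most `2 * b + 5` queries, whence `4 * b + 10`, once for the ambiguity and once for
the end of the string. -/
theorem extendRight_ensures {N : ℕ} (x : Fin N → Bool) (b K f r : ℕ) (s : List Bool)
    (n : ℕ) (hs : s <:+: List.ofFn x) (hsN : N < 2 * s.length) (hr : r ≤ 1)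
    (hr' : r = 0 → OccursOnce (List.ofFn x) s) (hf : N + 2 * b * r < s.length + 2 * b * f)
    (hn : N + K + 2 * f + r * (4 * b + 10) + (4 * b + 10) ≤ 2 * n + s.length) :
    (extendRight N b f s).Ensures (substringOracle x) n fun m z =>
      z <:+: List.ofFn x ∧ N + K ≤ 2 * m + z.length ∧ ∀ c, ¬ z ++ [c] <:+: List.ofFn x := by
  have hle : ∀ {t : List Bool}, t <:+: List.ofFn x → t.length ≤ N := fun ht => by
    simpa using ht.length_le
  induction f generalizing s n r with
  | zero =>
    have := hle hs
    rw [mul_zero] at hf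
    omega
  | succ f ih =>
    unfold extendRight
    have hsl := hle hs
    obtain ⟨n, rfl⟩ : ∃ n', n = (n' + 4) + 2 * b + 1 := ⟨n - (2 * b + 5), by omega⟩
    refine (verifiedSteps_ensures x (searchRight_ensures x) b s (n + 4) _ (fun h => absurd hs h)
      (fun t hst hl ht m hm => ?_) (fun t hst ht hbad m hm => ?_)).bind
    · rw [Nat.mul_succ] at hf
      exact ih r t m ht (by omega) hr (fun h => (hr' h).of_isPrefix hst) (by omega) (by omega)
    · have hst' := hst.length_le
      obtain ⟨m, rfl⟩ : ∃ m', m = m' + 2 := ⟨m - 2, by omega⟩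
      refine (carefulLetter_ensures x (by omega) (fun hend m' hm' => ?_)
        (fun c hu hc m' hm' => ?_)).bind
      · exact ⟨ht, by omega, hend⟩
      obtain ⟨m', rfl⟩ : ∃ k, m' = k + 2 := ⟨m' - 2, by omega⟩
      refine (carefulLetter_ensures x (by simp; omega) (fun hend k hk => ?_)
        (fun c' hv hc' k hk => ?_)).bind
      · exact ⟨hu, by simp; omega, hend⟩
      have hv' : t ++ [c, c'] <:+: List.ofFn x := by simpa using hv
      -- If both careful letters were forced, `(c, c')` would be the unique two-letter extension and
      -- the search would not have failed.
      have honce : OccursOnce (List.ofFn x) (t ++ [c] ++ [c']) := by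
        rcases hc with hc | hc
        · exact hc.of_isPrefix (List.prefix_append _ _)
        rcases hc' with hc' | hc'
        · exact hc'
        refine absurd ⟨(c, c'), fun l => ⟨fun h => ?_, fun h => h ▸ hv'⟩⟩ hbad
        obtain ⟨a, a'⟩ := l
        dsimp only at h
        have h1 : t ++ [a] <:+: List.ofFn x :=
          List.IsInfix.trans ⟨[], [a'], by simp⟩ h
        obtain rfl : a = c := by
          rcases Bool.eq_or_eq_not a c with h2 | h2
          · exact h2
          · exact absurd (h2 ▸ h1) hc
        have h3 : t ++ [a] ++ [a'] <:+: List.ofFn x := by simpa using h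
        rcases Bool.eq_or_eq_not a' c' with h2 | h2
        · rw [h2]
        · exact absurd (h2 ▸ h3) hc'
      -- A string occurring once has a unique two-letter extension, so the search could not have
      -- failed for `r = 0`.
      have hr1 : r = 1 := by
        by_contra hne
        have htonce := (hr' (by omega)).of_isPrefix hst
        refine hbad ⟨(c, c'), fun l => ⟨fun h => ?_, fun h => h ▸ hv'⟩⟩
        have := htonce.append_right_unique h hv' rfl
        simp only [List.cons.injEq, and_true] at this
        exact Prod.ext this.1 this.2
      subst hr1
      rw [Nat.mul_succ _ f] at hf
      refine ih 0 _ k hv ?_ (by omega) (fun _ => honce) ?_ ?_ <;> simp <;> omega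

/-- Extend a suffix of the unknown string to the left by `k` letters. -/
def extendLeft (N : ℕ) : ℕ → List Bool → Strategy (SubstringQuery N) (List Bool)
  | 0, s => .ret s
  | 1, s => (askString N (false :: s)).bind fun a => .ret ((!a) :: s)
  | k + 2, s => (searchString N fun l => l.1 :: l.2 :: s).bind fun l =>
      extendLeft N k (l.1 :: l.2 :: s)

/-- As `s` has no right extension, every substring ending in `s` is a suffix. So exactly one left
extension of each available length occurs, and exact search applies. -/
theorem extendLeft_ensures {N : ℕ} (x : Fin N → Bool) (k : ℕ) (s l : List Bool) (n : ℕ)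
    (hs : l ++ s = List.ofFn x) (hend : ∀ c, ¬ s ++ [c] <:+: List.ofFn x) (hk : l.length = k)
    (hn : k + 1 ≤ 2 * n) :
    (extendLeft N k s).Ensures (substringOracle x) n fun _ z => z = List.ofFn x := by
  have hsuffix : ∀ {t}, t ++ s <:+: List.ofFn x → t ++ s <:+ List.ofFn x := fun {t} ht =>
    isSuffix_of_forall_not_isInfix ht fun c hc =>
      hend c (List.IsInfix.trans ⟨t, [], by simp⟩ hc)
  induction k using Nat.twoStepInduction generalizing s l n with
  | zero =>
    obtain rfl := List.length_eq_zero_iff.1 hk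
    exact hs
  | one =>
    obtain ⟨a, rfl⟩ := List.length_eq_one_iff.1 hk
    obtain ⟨n, rfl⟩ : ∃ n', n = n' + 1 := ⟨n - 1, by omega⟩
    refine (askString_ensures x fun m hm b hb => ?_).bind
    change (!b) :: s = _
    rw [← hs]
    suffices h : (!b) = a by rw [h]; rfl
    cases a
    · have : b = true := hb.2 (by rw [← hs]; exact List.infix_refl _)
      rw [this]
      rfl
    · have : b = false := by
        rw [← Bool.not_eq_true, hb]
        intro h
        have h1 := (hsuffix (t := [false]) h).eq_of_length (by simp [← hs])
        rw [← hs] at h1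
        simp at h1
      rw [this]
      rfl
  | more k ih _ =>
    obtain ⟨l, b, rfl⟩ := List.eq_nil_or_concat' l |>.resolve_left (by rintro rfl; simp at hk)
    obtain ⟨l, a, rfl⟩ := List.eq_nil_or_concat' l |>.resolve_left (by rintro rfl; simp at hk)
    obtain ⟨n, rfl⟩ : ∃ n', n = n' + 1 := ⟨n - 1, by omega⟩
    simp only [List.append_assoc, List.cons_append, List.nil_append] at hs
    refine (searchString_ensures x (l := s.length + 2) (by omega) (fun i => by simp)
      fun m hm j hj => ?_).bind
    have hj' : j = (a, b) := by
      refine hj (a, b) fun i => ⟨fun h => ?_, ?_⟩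
      · have h1 := hsuffix (t := [i.1, i.2]) h
        have h2 : [a, b] ++ s <:+ List.ofFn x := ⟨l, by simpa using hs⟩
        have h3 := (List.suffix_of_suffix_length_le h1 h2 (by simp)).eq_of_length (by simp)
        simp only [List.cons_append, List.nil_append, List.cons.injEq, and_true] at h3
        exact Prod.ext h3.1 h3.2
      · rintro rfl
        exact List.IsSuffix.isInfix ⟨l, hs⟩
    subst hj'
    refine ih (a :: b :: s) l m hs (fun c hc => hend c (List.IsInfix.trans ⟨[a, b], [], by simp⟩ hc))
      (by simpa using hk) (by omega) fun {t} ht => ?_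
    have h1 : (t ++ [a, b]) ++ s <:+ List.ofFn x := hsuffix (by simpa using ht)
    simpa using h1

/-- The strategy which identifies a string from its substring oracle. -/
noncomputable def identify (N b L f f' : ℕ) : Strategy (SubstringQuery N) (Fin N → Bool) :=
  (findLongSubstring N b L f []).bind fun s =>
    (if s.2 then .ret s.1 else extendRight N b f' s.1).bind fun z =>
      (extendLeft N (N - z.length) z).bind fun y => .ret fun i => y.getD i false

/-- The reserve `21 + 2 * f' + 8 * b` is `1 + 2 * f' + 2 * (4 * b + 10)`: the losses of
`extendRight`, plus 1 for rounding when the number of missing left letters is odd. -/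
theorem identify_ensures {N : ℕ} (x : Fin N → Bool) {b L f f' n : ℕ} (hL : N < 2 * L)
    (hf : L ≤ b * f) (hf' : N + 2 * b < L + 2 * b * f')
    (hn : N + (L + b) + (21 + 2 * f' + 8 * b) + 2 * f + (4 * b + 2) ≤ 2 * n) :
    (identify N b L f f').Ensures (substringOracle x) n fun _ y => y = x := by
  refine ((findLongSubstring_ensures x b L (21 + 2 * f' + 8 * b) f [] n
    ⟨[], List.ofFn x, rfl⟩ (by simp) (by simpa using hf) (by simpa using hn)).mono ?_).bind
  rintro m ⟨s, flag⟩ ⟨hs, hm, htrue, hfalse⟩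
  dsimp only at hs hm htrue hfalse
  refine Ensures.bind (Ensures.mono (P := fun m z => z <:+: List.ofFn x ∧
    N + 1 ≤ 2 * m + z.length ∧ ∀ c, ¬ z ++ [c] <:+: List.ofFn x) ?_ ?_)
  · rintro m z ⟨hz, hm, hend⟩
    obtain ⟨l, hl⟩ := isSuffix_of_forall_not_isInfix hz hend
    have hlen := congrArg List.length hl
    rw [List.length_append, List.length_ofFn] at hlen
    refine ((extendLeft_ensures x (N - z.length) z l m hl hend (by omega) (by omega)).mono ?_).bind
    rintro _ y rfl
    funext i
    simp
  · cases flag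
    · have hsL := hfalse rfl
      exact extendRight_ensures x b 1 f' 1 s m hs (by omega) le_rfl (by simp) (by omega) (by omega)
    · exact ⟨hs, by dsimp only; omega, htrue rfl⟩

end SubstringQuery

theorem theorem1 :
    ∃ C : ℝ, ∀ N : ℕ, 2 ≤ N →
      ∃ A : QueryAlgorithm (SubstringQuery N) (Fin N → Bool),
        IdentifiesExactly A ∧
          (A.queries : ℝ) ≤ 3 / 4 * (N : ℝ) + C * (Real.sqrt N * Real.log N) := by
  refine ⟨50, fun N hN => ?_⟩
  have : Inhabited (SubstringQuery N) := ⟨⟨[false], by simp, by simp; omega⟩⟩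
  obtain ⟨b, hb⟩ : ∃ b, b = N.sqrt + 1 := ⟨_, rfl⟩
  have hbN : N < b * b := hb ▸ Nat.lt_succ_sqrt N
  refine ⟨(SubstringQuery.identify N b (N / 2 + 1) b (b + 1)).toQueryAlgorithm
    ((N + N / 2 + 17 * b + 26) / 2 + 1), fun x => ?_, ?_⟩
  · refine Strategy.outputProb_toQueryAlgorithm _ _ _ _
      (SubstringQuery.identify_ensures x (by omega) (by omega) ?_ (by omega))
    rw [mul_add, mul_assoc]
    omega
  · change (((N + N / 2 + 17 * b + 26) / 2 + 1 : ℕ) : ℝ) ≤ _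
    have h1 : 4 * ((N + N / 2 + 17 * b + 26) / 2 + 1) ≤ 3 * N + 34 * b + 56 := by omega
    have h2 : (4 : ℝ) * ((N + N / 2 + 17 * b + 26) / 2 + 1 : ℕ) ≤ 3 * N + 34 * b + 56 := by
      exact_mod_cast h1
    have h3 : (b : ℝ) ≤ √N + 1 := by
      rw [hb]
      push_cast
      gcongr
      exact Real.nat_sqrt_le_real_sqrt
    have hN' : (2 : ℝ) ≤ N := by exact_mod_cast hN
    have h4 : 1 ≤ √(N : ℝ) := Real.one_le_sqrt.2 (by linarith)
    have h5 : 0.69 ≤ Real.log N :=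
      -- The overhead is in fact `O(√N)`; the logarithm enters only through the lower bound `0.69`,
      -- just below `log 2`.
      le_trans (by linarith [Real.log_two_gt_d9]) (Real.log_le_log (by norm_num) hN')
    have h6 : √(N : ℝ) * 0.69 ≤ √(N : ℝ) * Real.log N := by gcongr
    linarith
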